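/- A hypergraph is $r$-uniform if it is a family of $r$-element subsets (edges) of a finite vertex set. A hypergraph $\mathcal H$ contains a graph $F$ with vertices $v_1,\dots,v_p$ and edges $e_1,\dots,e_q$ as a trace if there are distinct vertices $w_1,\dots,w_p$ of $\mathcal H$, forming the set $W=\{w_1,\dots,w_p\}$, and distinct edges $f_1,\dots,f_q$ of $\mathcal H$ such that $f_i\cap W=\{w_\alpha,w_\beta\}$ whenever $e_i=v_\alpha v_\beta$. Let $\mathrm{ex}_r(n,\mathrm{Tr}(F))$ be the maximum number of edges of an $n$-vertex $r$-uniform hypergraph that does not contain $F$ as a trace, and let $K_{1,t}$ be the star with $t$ edges. **Theorem.** Let $n\ge 0$ and $t\ge 1$ be integers with $(t+2)\mid n$. 1. If $t+2\equiv 0 \pmod 6$, then $\mathrm{ex}_3(n,\mathrm{Tr}(K_{1,t}))=\frac n6\,(t^2-2)$. 2. If $t+2\equiv 1$ or $3 \pmod 6$, then $\mathrm{ex}_3(n,\mathrm{Tr}(K_{1,t}))=\frac n6\,(t^2-1)$. -/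

import Mathlib

/-- The set family `H` (a hypergraph with vertex set `V` and edge set `H`) contains the graph `F`
as a trace: there are distinct base vertices `w u` (one for each vertex `u` of `F`; their set is
`Set.range w`) and distinct edges `f e ∈ H` (one for each edge `e` of `F`) such that the
intersection of `f e` with the set of base vertices is exactly the image of `e`. -/
def ContainsTrace {U V : Type*} (H : Finset (Finset V)) (F : SimpleGraph U) : Prop :=
  ∃ (w : U ↪ V) (f : F.edgeSet ↪ Finset V), ∀ e : F.edgeSet,
    f e ∈ H ∧ (f e : Set V) ∩ Set.range w = w '' {u | u ∈ (e : Sym2 U)}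

/-- The Turán number `ex_r(n, Tr(F))`: the maximum number of edges of an `r`-uniform hypergraph on
`n` vertices that does not contain `F` as a trace. (The set below is bounded by the number of
subsets of `Fin n`, and contains `0` as soon as `F` has an edge.) -/
noncomputable def exTrace {U : Type*} (r n : ℕ) (F : SimpleGraph U) : ℕ :=
  sSup {m : ℕ | ∃ H : Finset (Finset (Fin n)),
    (H : Set (Finset (Fin n))).Sized r ∧ ¬ ContainsTrace H F ∧ H.card = m}

/-! Upper bound: in the link graph of a vertex `v`, any `t` vertices of a set whose members all have
neighbours outside it are leaves of a star trace centred at `v`. In a trace-free family such sets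
have size at most `t - 1`, so Vizing's bound limits the degree sum of the link, which is twice the
number of edges through `v`, to `t² - 1`. For even `t` parity improves this to `t² - 2`. Summing
over `v` counts every edge three times.

Lower bound: take `n / (t + 2)` disjoint copies of the complement of a pair cover on `t + 2` points.
A star trace stays in one copy and uses all its points but one, `x`, so its edges are all the
triples through `x` and the centre `c`. One of those lies in the cover, hence is missing. Optimal
covers meet the upper bound: Steiner triple systems (Bose, Skolem) for `t + 2 ≡ 3, 1`, and covers
with `(t + 2)² / 6` triples for `t + 2 ≡ 0`. -/

open Finset

/-! ### Stars as traces -/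

section Star

variable {V : Type*} {t : ℕ}

/-- A set family contains the star `K_{1,t}` as a trace iff there are a centre `v`, leaves `g i`
and members `e i` of the family through `v` such that `g i` is the only leaf in `e i`. -/
theorem containsTrace_star_iff (H : Finset (Finset V)) :
    ContainsTrace H (completeBipartiteGraph (Fin 1) (Fin t)) ↔
      ∃ (v : V) (g : Fin t ↪ V) (e : Fin t → Finset V), (∀ i, g i ≠ v) ∧
        ∀ i, e i ∈ H ∧ v ∈ e i ∧ ∀ j, g j ∈ e i ↔ j = i := by
  constructor
  · rintro ⟨w, f, hf⟩
    have hadj : ∀ i : Fin t, s(Sum.inl 0, Sum.inr i) ∈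
        (completeBipartiteGraph (Fin 1) (Fin t)).edgeSet := fun i => by simp
    refine ⟨w (Sum.inl 0), ⟨fun i => w (Sum.inr i), fun i j h => by simpa using h⟩,
      fun i => f ⟨_, hadj i⟩, fun i h => by simpa using w.injective h, fun i => ?_⟩
    obtain ⟨hH, hw⟩ := hf ⟨_, hadj i⟩
    have hmem : ∀ u, w u ∈ f ⟨_, hadj i⟩ ↔ u = Sum.inl 0 ∨ u = Sum.inr i := fun u => by
      have := Set.ext_iff.1 hw (w u)
      simpa using this
    exact ⟨hH, (hmem _).2 (Or.inl rfl), fun j => (hmem _).trans (by simp)⟩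
  · rintro ⟨v, g, e, hv, he⟩
    have hw : Function.Injective (Sum.elim (fun _ : Fin 1 => v) g) := by
      rintro (i | i) (j | j) h
      · simp [Subsingleton.elim i j]
      · exact absurd h.symm (hv j)
      · exact absurd h (hv i)
      · simpa using h
    have hedge : ∀ x : (completeBipartiteGraph (Fin 1) (Fin t)).edgeSet,
        ∃ i : Fin t, (x : Sym2 (Fin 1 ⊕ Fin t)) = s(Sum.inl 0, Sum.inr i) := by
      rintro ⟨x, hx⟩
      induction x using Sym2.ind with
      | _ a b =>
        rcases a with a | a <;> rcases b with b | b <;> simp at hx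
        · exact ⟨b, by simp [Subsingleton.elim a 0]⟩
        · exact ⟨a, by simp [Subsingleton.elim b 0, Sym2.eq_swap]⟩
    choose c hc using hedge
    refine ⟨⟨_, hw⟩, ⟨fun x => e (c x), fun x y hxy => ?_⟩, fun x => ⟨(he _).1, ?_⟩⟩
    · have h1 : g (c x) ∈ e (c y) := by
        rw [← show e (c x) = e (c y) from hxy]
        exact ((he _).2.2 _).2 rfl
      exact Subtype.ext (by rw [hc x, hc y, ((he _).2.2 _).1 h1])
    · ext z
      rw [hc x]
      constructor
      · rintro ⟨hz, u | u, rfl⟩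
        · exact ⟨Sum.inl 0, by simp, rfl⟩
        · exact ⟨Sum.inr u, by simpa using ((he _).2.2 u).1 hz, rfl⟩
      · rintro ⟨u, hu, rfl⟩
        refine ⟨?_, u, rfl⟩
        have : u = Sum.inl 0 ∨ u = Sum.inr (c x) := by simpa using hu
        rcases this with rfl | rfl
        · exact (he _).2.1
        · exact ((he _).2.2 _).2 rfl

end Star

/-! ### Vizing's bound -/

section Vizing

variable {V : Type*} [DecidableEq V]

/-- **Vizing's bound**: if every set of vertices of the graph induced on `A` all of whose members
have a neighbour outside of the set has at most `k` elements, then the degree sum is at most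
`k (k + 2)`. -/
theorem SimpleGraph.sum_degree_le_of_dominated_card_le (G : SimpleGraph V) [DecidableRel G.Adj]
    (k : ℕ) (A : Finset V)
    (h : ∀ S ⊆ A, (∀ s ∈ S, ∃ u ∈ A \ S, G.Adj s u) → #S ≤ k) :
    ∑ a ∈ A, #{b ∈ A | G.Adj a b} ≤ k * (k + 2) := by
  induction k using Nat.strong_induction_on generalizing A with
  | _ k ih =>
  rcases A.eq_empty_or_nonempty with rfl | hA
  · simp
  obtain ⟨v, hvA, hmax⟩ := A.exists_max_image (fun a => #{b ∈ A | G.Adj a b}) hA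
  set N := {b ∈ A | G.Adj v b} with hN
  rcases Nat.eq_zero_or_pos #N with h0 | hpos
  · rw [Finset.sum_eq_zero fun a ha => Nat.le_zero.1 (h0 ▸ hmax a ha)]
    exact Nat.zero_le _
  have hvN : v ∉ N := by simp [hN]
  have hNA : N ⊆ A := filter_subset _ _
  have hNk : #N ≤ k := h N hNA fun s hs =>
    ⟨v, mem_sdiff.2 ⟨hvA, hvN⟩, (mem_filter.1 hs).2.symm⟩
  obtain ⟨r, rfl⟩ := Nat.exists_eq_add_of_le hNk
  set S := A \ insert v N with hS
  have hSA : S ⊆ A := sdiff_subset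
  have hvS : v ∉ S := by simp [hS]
  have hSN : Disjoint S N := by
    rw [hS]; exact disjoint_sdiff_self_left.mono_right (subset_insert _ _)
  have hvNA : insert v N ⊆ A := insert_subset hvA hNA
  have h1 : ∑ a ∈ S, #{b ∈ S | G.Adj a b} ≤ r * (r + 2) := by
    -- A dominated `T ⊆ S` stays dominated after adding `N`: `T` from inside `S`, and `N` by `v`.
    refine ih r (by omega) S fun T hT hdom => ?_
    have hd : Disjoint T N := hSN.mono_left hT
    have := h (T ∪ N) (union_subset (hT.trans hSA) hNA) fun s hs => by
      rcases mem_union.1 hs with hs | hs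
      · obtain ⟨u, hu, hsu⟩ := hdom s hs
        rw [mem_sdiff] at hu
        exact ⟨u, mem_sdiff.2 ⟨hSA hu.1, fun h => (mem_union.1 h).elim hu.2
          (Finset.disjoint_left.1 hSN hu.1)⟩, hsu⟩
      · exact ⟨v, mem_sdiff.2 ⟨hvA, by
          simp only [mem_union, not_or]; exact ⟨fun hv => hvS (hT hv), hvN⟩⟩,
          (mem_filter.1 hs).2.symm⟩
    rw [card_union_of_disjoint hd] at this
    omega
  -- Trade `u` for its neighbours in `S`: these are dominated by `u`, and the rest of `N` by `v`.
  have h2 : ∀ u ∈ N, #{b ∈ S | G.Adj u b} ≤ r + 1 := fun u hu => by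
    have hd : Disjoint {b ∈ S | G.Adj u b} (N.erase u) :=
      (hSN.mono_left (filter_subset _ _)).mono_right (erase_subset _ _)
    have := h ({b ∈ S | G.Adj u b} ∪ N.erase u)
      (union_subset ((filter_subset _ _).trans hSA) ((erase_subset _ _).trans hNA)) fun s hs => by
        rcases mem_union.1 hs with hs | hs
        · exact ⟨u, mem_sdiff.2 ⟨hNA hu, by simp⟩, (mem_filter.1 hs).2.symm⟩
        · exact ⟨v, mem_sdiff.2 ⟨hvA, by simp [hvS, hvN]⟩,
            (mem_filter.1 (mem_of_mem_erase hs)).2.symm⟩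
    rw [card_union_of_disjoint hd, card_erase_of_mem hu] at this
    omega
  have h3 : ∑ a ∈ S, #{b ∈ A | G.Adj a b} =
      ∑ a ∈ S, #{b ∈ S | G.Adj a b} + ∑ a ∈ N, #{b ∈ S | G.Adj a b} := by
    have hswap : ∑ a ∈ N, #{b ∈ S | G.Adj a b} = ∑ a ∈ S, #{b ∈ N | G.Adj a b} := by
      refine (sum_card_bipartiteAbove_eq_sum_card_bipartiteBelow G.Adj).trans ?_
      simp [bipartiteBelow, G.adj_comm]
    rw [hswap, ← sum_add_distrib]
    refine sum_congr rfl fun a ha => ?_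
    rw [← card_union_of_disjoint ((hSN.mono_left (filter_subset _ _)).mono_right
      (filter_subset _ _)), ← filter_union]
    congr 1
    ext b
    simp only [mem_filter, mem_union, hS, mem_sdiff, mem_insert]
    constructor
    · rintro ⟨hb, hab⟩
      have hbv : b ≠ v := by
        rintro rfl
        exact (mem_sdiff.1 ha).2 (mem_insert_of_mem (mem_filter.2 ⟨hSA ha, hab.symm⟩))
      exact ⟨by tauto, hab⟩
    · rintro ⟨hb | hb, hab⟩
      · exact ⟨hb.1, hab⟩
      · exact ⟨hNA hb, hab⟩
  have h4 : ∑ a ∈ N, #{b ∈ S | G.Adj a b} ≤ #N * (r + 1) := by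
    simpa using Finset.sum_le_card_nsmul N _ _ h2
  have h5 : ∑ a ∈ N, #{b ∈ A | G.Adj a b} ≤ #N * #N := by
    simpa using Finset.sum_le_card_nsmul N _ _ fun a ha => hmax a (hNA ha)
  rw [← sum_sdiff hvNA, sum_insert hvN, ← hS, h3]
  nlinarith

end Vizing

/-! ### The upper bound -/

section UpperBound

variable {V : Type*} [DecidableEq V]

/-- The link graph of the vertex `v` in a `3`-uniform family. -/
def linkGraph (H : Finset (Finset V)) (v : V) : SimpleGraph V where
  Adj a b := a ≠ v ∧ b ≠ v ∧ a ≠ b ∧ {v, a, b} ∈ H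
  symm := ⟨fun a b ⟨ha, hb, hab, h⟩ => ⟨hb, ha, hab.symm, by rwa [Finset.pair_comm b a]⟩⟩
  loopless := ⟨fun a h => h.2.2.1 rfl⟩

instance (H : Finset (Finset V)) (v : V) : DecidableRel (linkGraph H v).Adj :=
  fun a b => inferInstanceAs (Decidable (a ≠ v ∧ b ≠ v ∧ a ≠ b ∧ {v, a, b} ∈ H))

variable {H : Finset (Finset V)} {t : ℕ}

/-- For `s ∈ S` with a neighbour `u ∉ S`, the edge `{v, s, u}` meets `S` only in `s`, so `t` members
of `S` would serve as leaves. -/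
theorem card_lt_of_dominated_linkGraph
    (hfree : ¬ ContainsTrace H (completeBipartiteGraph (Fin 1) (Fin t))) (v : V) (S : Finset V)
    (hS : ∀ s ∈ S, ∃ u ∉ S, (linkGraph H v).Adj s u) : #S < t := by
  by_contra! hcard
  refine hfree ((containsTrace_star_iff H).2 ?_)
  obtain ⟨T, hTS, hT⟩ := exists_subset_card_eq hcard
  let g : Fin t ↪ V := (T.equivFinOfCardEq hT).symm.toEmbedding.trans (Function.Embedding.subtype _)
  have hg : ∀ i, g i ∈ S := fun i => hTS ((T.equivFinOfCardEq hT).symm i).2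
  choose u hu hadj using fun i => hS (g i) (hg i)
  refine ⟨v, g, fun i => {v, g i, u i}, fun i => (hadj i).1, fun i => ⟨(hadj i).2.2.2, by simp,
    fun j => ?_⟩⟩
  have h1 : g j ≠ u i := fun h => hu i (h ▸ hg j)
  simp [h1, (hadj j).1]

theorem two_mul_card_filter_mem_le [Fintype V] (hH : (H : Set (Finset V)).Sized 3)
    (hfree : ¬ ContainsTrace H (completeBipartiteGraph (Fin 1) (Fin (t + 1)))) (v : V) :
    2 * #{e ∈ H | v ∈ e} ≤ t * (t + 2) := by
  have hviz := (linkGraph H v).sum_degree_le_of_dominated_card_le t univ fun S _ hS =>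
    Nat.lt_succ_iff.1 (card_lt_of_dominated_linkGraph hfree v S (by simpa using hS))
  refine le_trans ?_ hviz
  have h2 : ∑ e ∈ H with v ∈ e, #{a : V | a ∈ e.erase v} = 2 * #{e ∈ H | v ∈ e} := by
    rw [sum_const_nat (m := 2), mul_comm]
    intro e he
    rw [mem_filter] at he
    simp [-mem_erase, card_erase_of_mem he.2, hH he.1]
  rw [← h2]
  refine (sum_card_bipartiteAbove_eq_sum_card_bipartiteBelow
    (fun (e : Finset V) a => a ∈ e.erase v)).trans_le ?_
  -- An edge through `v` and `a` is determined by its third point, a neighbour of `a` in the link.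
  refine sum_le_sum fun a _ => ?_
  refine card_le_card_of_surjOn (fun b => {v, a, b}) fun e he => ?_
  simp only [bipartiteBelow, coe_filter, mem_filter, mem_erase, Set.mem_ofPred_eq] at he
  obtain ⟨⟨heH, hve⟩, hav, hae⟩ := he
  have hcard : #((e.erase v).erase a) = 1 := by
    rw [card_erase_of_mem (mem_erase.2 ⟨hav, hae⟩), card_erase_of_mem hve, hH heH]
  obtain ⟨b, hb⟩ := card_eq_one.1 hcard
  have hbm : b ∈ (e.erase v).erase a := by simp [hb]
  simp only [mem_erase] at hbm
  have he : ({v, a, b} : Finset V) = e := by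
    rw [← hb, insert_erase (mem_erase.2 ⟨hav, hae⟩), insert_erase hve]
  exact ⟨b, by simpa [linkGraph, hav, hbm.2.1, he, heH] using hbm.1.symm, he⟩

/-- If every vertex lies in at most `c / 2` members of a `3`-uniform family on `n` vertices, then
the family has at most `n c / 6` members. -/
theorem six_mul_card_le [Fintype V] (hH : (H : Set (Finset V)).Sized 3) {c : ℕ}
    (hc : ∀ v, 2 * #{e ∈ H | v ∈ e} ≤ c) : 6 * #H ≤ Fintype.card V * c := by
  have h3 : ∑ e ∈ H, #{a : V | a ∈ e} = 3 * #H := by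
    rw [sum_const_nat (m := 3), mul_comm]
    intro e he
    simp [hH he]
  have h3' := (sum_card_bipartiteAbove_eq_sum_card_bipartiteBelow
    (fun (e : Finset V) a => a ∈ e)).symm.trans h3
  have h4 : ∑ v : V, 2 * #{e ∈ H | v ∈ e} ≤ Fintype.card V * c := by
    simpa using Finset.sum_le_card_nsmul univ _ c fun v _ => hc v
  rw [← mul_sum] at h4
  simp only [bipartiteBelow] at h3'
  omega

end UpperBound

/-! ### The lower bound from covers of pairs by triples -/

/-- A set family covers all pairs by triples if every two distinct points lie in a common
three-element member. -/
def IsPairCover {α : Type*} [DecidableEq α] (B : Finset (Finset α)) : Prop :=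
  ∀ a b, a ≠ b → ∃ c, c ≠ a ∧ c ≠ b ∧ {a, b, c} ∈ B

section LowerBound

variable {α : Type*} [DecidableEq α] [Fintype α] {V : Type*} [DecidableEq V] {m t : ℕ}

/-- The disjoint union, along `φ`, of `m` copies of the family of all triples not in `B`. -/
def copiesOfCompl (φ : Fin m × α ↪ V) (B : Finset (Finset α)) : Finset (Finset V) :=
  ((univ : Finset (Fin m)) ×ˢ (powersetCard 3 univ \ B)).image
    fun p => p.2.image fun a => φ (p.1, a)

theorem mem_copiesOfCompl {φ : Fin m × α ↪ V} {B : Finset (Finset α)} {e : Finset V} :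
    e ∈ copiesOfCompl φ B ↔ ∃ (i : Fin m) (f : Finset α), #f = 3 ∧ f ∉ B ∧
      f.image (fun a => φ (i, a)) = e := by
  simp [copiesOfCompl, and_assoc]

theorem sized_copiesOfCompl (φ : Fin m × α ↪ V) (B : Finset (Finset α)) :
    (copiesOfCompl φ B : Set (Finset V)).Sized 3 := by
  intro e he
  obtain ⟨i, f, hf, -, rfl⟩ := mem_copiesOfCompl.1 (mem_coe.1 he)
  rw [card_image_of_injective _ fun a b h => by simpa using h, hf]

theorem card_copiesOfCompl (φ : Fin m × α ↪ V) (B : Finset (Finset α)) :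
    m * (Fintype.card α).choose 3 ≤ #(copiesOfCompl φ B) + m * #B := by
  rw [copiesOfCompl, card_image_of_injOn, card_product, card_univ, Fintype.card_fin, ← mul_add]
  · refine Nat.mul_le_mul_left _ ?_
    rw [← card_univ, ← card_powersetCard]
    have := le_card_sdiff B (powersetCard 3 (univ : Finset α))
    omega
  · rintro ⟨i, f⟩ hf ⟨j, g⟩ hg h
    simp only [coe_product, Set.mem_prod, mem_coe, mem_sdiff, mem_powersetCard] at hf hg
    simp only at h
    obtain ⟨a, ha⟩ : f.Nonempty := card_pos.1 (by omega)
    have h1 := h ▸ mem_image_of_mem (fun a => φ (i, a)) ha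
    simp only [mem_image, EmbeddingLike.apply_eq_iff_eq, Prod.mk.injEq] at h1
    obtain ⟨b, -, rfl, -⟩ := h1
    rw [image_injective (fun a b h => by simpa using h) h]

theorem not_containsTrace_copiesOfCompl (φ : Fin m × α ↪ V) {B : Finset (Finset α)}
    (hB : IsPairCover B) (hα : Fintype.card α = t + 2) (ht : 0 < t) :
    ¬ ContainsTrace (copiesOfCompl φ B) (completeBipartiteGraph (Fin 1) (Fin t)) := by
  rw [containsTrace_star_iff]
  rintro ⟨v, g, e, hgv, he⟩
  choose he hv hg using he
  choose i f hf hfB hfe using fun k => mem_copiesOfCompl.1 (he k)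
  have hmem : ∀ k x, x ∈ e k ↔ ∃ a ∈ f k, φ (i k, a) = x := fun k x => by simp [← hfe k]
  obtain ⟨c, -, hc⟩ := (hmem ⟨0, ht⟩ _).1 (hv ⟨0, ht⟩)
  obtain ⟨p, hp⟩ : ∃ p, p = i ⟨0, ht⟩ := ⟨_, rfl⟩
  rw [← hp] at hc
  have hi : ∀ k, i k = p ∧ c ∈ f k := fun k => by
    obtain ⟨a, ha, h⟩ := (hmem k _).1 (hv k)
    rw [← hc] at h
    simp only [EmbeddingLike.apply_eq_iff_eq, Prod.mk.injEq] at h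
    exact ⟨h.1, h.2 ▸ ha⟩
  have hleaf : ∀ k, ∃ a ∈ f k, φ (p, a) = g k := fun k => by
    simpa [(hi k).1] using (hmem k _).1 ((hg k k).2 rfl)
  choose l hlf hl using hleaf
  have hlinj : Function.Injective l := fun a b h => g.injective (by rw [← hl, ← hl, h])
  have hlc : ∀ k, l k ≠ c := fun k h => hgv k (by rw [← hl, h, hc])
  have hlk : ∀ j k, l j ∈ f k → j = k := fun j k h =>
    (hg k j).1 ((hmem k _).2 ⟨l j, h, by rw [(hi k).1, hl]⟩)
  -- Centre and leaves fill `t + 1` of the `t + 2` points; the third point of every edge is the one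
  -- left over.
  set W : Finset α := insert c (univ.image l) with hW
  have hWcard : #W = t + 1 := by
    rw [hW, card_insert_of_notMem (by simpa using hlc), card_image_of_injective _ hlinj]
    simp
  obtain ⟨x, hx⟩ := card_eq_one.1 (show #Wᶜ = 1 by rw [card_compl, hα, hWcard]; omega)
  have hxW : ∀ y, y ∉ W ↔ y = x := fun y => by rw [← mem_compl, hx, mem_singleton]
  have hfx : ∀ k, f k = {c, x, l k} := fun k => by
    have hcf : #((f k).erase c |>.erase (l k)) = 1 := by
      rw [card_erase_of_mem (mem_erase.2 ⟨hlc k, hlf k⟩), card_erase_of_mem (hi k).2, hf]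
    obtain ⟨y, hy⟩ := card_eq_one.1 hcf
    have hym : y ∈ ((f k).erase c).erase (l k) := by simp [hy]
    simp only [mem_erase] at hym
    have hyx : y = x := (hxW y).1 fun h => by
      rcases mem_insert.1 h with h | h
      · exact hym.2.1 h
      · obtain ⟨j, -, rfl⟩ := mem_image.1 h
        exact hym.1 (by rw [hlk j k hym.2.2])
    rw [pair_comm, ← hyx, ← hy, insert_erase (mem_erase.2 ⟨hlc k, hlf k⟩), insert_erase (hi k).2]
  have hxc : c ≠ x := fun h => (hxW x).2 rfl (h ▸ mem_insert_self _ _)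
  obtain ⟨y, hyc, hyx, hyB⟩ := hB c x hxc
  have hyW : y ∈ W := by by_contra h; exact hyx ((hxW y).1 h)
  obtain ⟨k, -, rfl⟩ := mem_image.1 ((mem_insert.1 hyW).resolve_left hyc)
  exact hfB k (hfx k ▸ hyB)

end LowerBound

/-! ### Covers of pairs by triples -/

section PairCover

variable {α : Type*} [DecidableEq α]

variable {Q : Type*} [DecidableEq Q] [Fintype Q]

/-- The triples `{(x, j), (y, j), (x ∘ y, j + 1)}` with `x ≠ y`. -/
def mixedTriples (op : Sym2 Q → Q) : Finset (Finset (Q × ZMod 3)) :=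
  (((univ : Finset (Sym2 Q)).filter fun s => ¬ s.IsDiag) ×ˢ univ).image
    fun p => insert (op p.1, p.2 + 1) (p.1.toFinset.image fun x => (x, p.2))

theorem mem_mixedTriples (op : Sym2 Q → Q) {x y : Q} (h : x ≠ y) (j : ZMod 3) :
    {(x, j), (y, j), (op s(x, y), j + 1)} ∈ mixedTriples op := by
  refine mem_image.2 ⟨(s(x, y), j), by simpa using h, ?_⟩
  ext z
  simp
  tauto

theorem card_mixedTriples_le (op : Sym2 Q → Q) :
    #(mixedTriples op) ≤ (Fintype.card Q).choose 2 * 3 := by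
  refine card_image_le.trans ?_
  rw [card_product, ← Sym2.card_subtype_not_diag, Fintype.card_subtype]
  simp

theorem zmod_three_cases (i j : ZMod 3) : i = j ∨ j = i + 1 ∨ i = j + 1 := by
  revert i j; decide

/-- If `op` has solvable equations `x ∘ y = z`, the mixed triples cover all pairs except
possibly those of the form `(x, j), (x ∘ x, j + 1)`. -/
theorem exists_triple_of_mixedTriples_subset {op : Sym2 Q → Q}
    (hop : ∀ x z, ∃ y, op s(x, y) = z) (i : Q × ZMod 3 ↪ α) {B : Finset (Finset α)}
    (hsub : ∀ b ∈ mixedTriples op, b.image i ∈ B)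
    (hdiag : ∀ x j, ∃ c, c ≠ i (x, j) ∧ c ≠ i (op s(x, x), j + 1) ∧
      {i (x, j), i (op s(x, x), j + 1), c} ∈ B)
    (p q : Q × ZMod 3) (hpq : p ≠ q) : ∃ c, c ≠ i p ∧ c ≠ i q ∧ {i p, i q, c} ∈ B := by
  have key : ∀ x z j, ∃ c, c ≠ i (x, j) ∧ c ≠ i (z, j + 1) ∧ {i (x, j), i (z, j + 1), c} ∈ B := by
    intro x z j
    -- Solving `x ∘ y = z` makes `(y, j)` the third point, unless `y = x`.
    obtain ⟨y, rfl⟩ := hop x z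
    by_cases h : x = y
    · subst h; exact hdiag x j
    · refine ⟨i (y, j), by simpa using Ne.symm h, by simp, ?_⟩
      have := hsub _ (mem_mixedTriples op h j)
      rw [pair_comm]
      simpa [image_insert] using this
  obtain ⟨x, j⟩ := p
  obtain ⟨z, k⟩ := q
  rcases zmod_three_cases j k with rfl | rfl | rfl
  · have h : x ≠ z := fun h => hpq (by rw [h])
    refine ⟨i (op s(x, z), j + 1), by simp, by simp, ?_⟩
    simpa [image_insert] using hsub _ (mem_mixedTriples op h j)
  · exact key x z j
  · obtain ⟨c, h1, h2, h3⟩ := key z x k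
    exact ⟨c, h2, h1, by rwa [insert_comm]⟩

/-- The Bose construction of Steiner triple systems on `6k + 3` points. -/
theorem exists_pairCover_six_mul_add_three (k : ℕ) :
    ∃ B : Finset (Finset (ZMod (2 * k + 1) × ZMod 3)), IsPairCover B ∧
      6 * #B ≤ (6 * k + 3) * (6 * k + 2) := by
  -- Since `k + 1` inverts `2`, the operation below is the midpoint, which is idempotent; vertical
  -- triples cover the diagonal pairs.
  have hinv : (2 : ZMod (2 * k + 1)) * (k + 1) = 1 := by
    have : ((2 * k + 1 : ℕ) : ZMod (2 * k + 1)) = 0 := ZMod.natCast_self _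
    push_cast at this
    linear_combination this
  let op : Sym2 (ZMod (2 * k + 1)) → ZMod (2 * k + 1) :=
    Sym2.lift ⟨fun x y => (x + y) * (k + 1), fun x y => by ring⟩
  have hop : ∀ x y, op s(x, y) = (x + y) * (k + 1) := fun x y => rfl
  have hdiag : ∀ x, op s(x, x) = x := fun x => by rw [hop]; linear_combination x * hinv
  refine ⟨mixedTriples op ∪ univ.image fun x => {(x, 0), (x, 1), (x, 2)}, ?_, ?_⟩
  · refine exists_triple_of_mixedTriples_subset (op := op) (fun x z => ⟨2 * z - x, ?_⟩)
      (Function.Embedding.refl _) (fun b hb => ?_) fun x j => ?_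
    · rw [hop]; linear_combination z * hinv
    · exact mem_union_left _ (by
        rwa [Function.Embedding.coe_refl, image_id])
    · refine ⟨(x, j + 2), ?_, ?_, mem_union_right _ (mem_image.2 ⟨x, mem_univ _, ?_⟩)⟩
      · simp; decide
      · simp [hdiag]; decide
      · rw [hdiag]
        revert j
        have : ∀ j : ZMod 3, ({0, 1, 2} : Finset (ZMod 3)) = {j, j + 1, j + 2} := by decide
        intro j
        simpa [image_insert] using congrArg (Finset.image fun a => (x, a)) (this j)
  · have h1 := card_mixedTriples_le op
    have h2 : #(univ.image fun x : ZMod (2 * k + 1) =>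
      ({(x, 0), (x, 1), (x, 2)} : Finset (ZMod (2 * k + 1) × ZMod 3))) ≤ 2 * k + 1 :=
      card_image_le.trans (by simp [ZMod.card])
    rw [ZMod.card, Nat.choose_two_right,
      show (2 * k + 1) * (2 * k + 1 - 1) / 2 = (2 * k + 1) * k by
        rw [show 2 * k + 1 - 1 = 2 * k by omega]; apply Nat.div_eq_of_eq_mul_left <;> grind] at h1
    have h3 := card_union_le (mixedTriples op) (univ.image fun x : ZMod (2 * k + 1) =>
      ({(x, 0), (x, 1), (x, 2)} : Finset (ZMod (2 * k + 1) × ZMod 3)))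
    nlinarith

/-- The half-idempotent commutative quasigroup of even order. -/
theorem exists_halfIdempotent (k : ℕ) : ∃ op : Sym2 (Fin (2 * k)) → Fin (2 * k),
    (∀ x z, ∃ y, op s(x, y) = z) ∧
    ∀ x, ((op s(x, x) : Fin (2 * k)) : ℕ) = if (x : ℕ) < k then (x : ℕ) else x - k := by
  -- Addition mod `2k`, relabelled by a bijection sending evens `2i` to `i` and odds `2i + 1` to `i
  -- + k`. The diagonal sums are even.
  let red : ℕ → ℕ := fun s => if s < 2 * k then s else s - 2 * k
  have hred : ∀ x y : Fin (2 * k), red (x + y) < 2 * k := fun x y => by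
    simp only [red]; split_ifs <;> omega
  let op : Sym2 (Fin (2 * k)) → Fin (2 * k) := Sym2.lift ⟨fun x y =>
    ⟨if red (x + y) % 2 = 0 then red (x + y) / 2 else red (x + y) / 2 + k, by
      have := hred x y
      split_ifs <;> omega⟩, fun x y => by rw [Fin.mk.injEq, add_comm]⟩
  have hop : ∀ x y, (op s(x, y) : ℕ) =
      if red (x + y) % 2 = 0 then red (x + y) / 2 else red (x + y) / 2 + k := fun x y => rfl
  refine ⟨op, fun x z => ?_, fun x => ?_⟩
  · obtain ⟨w, hw, hwz⟩ : ∃ w < 2 * k, (if w % 2 = 0 then w / 2 else w / 2 + k) = z := by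
      by_cases hz : (z : ℕ) < k
      · exact ⟨2 * z, by omega, by split_ifs <;> omega⟩
      · exact ⟨2 * (z - k) + 1, by omega, by split_ifs <;> omega⟩
    refine ⟨⟨if (x : ℕ) ≤ w then w - x else w + 2 * k - x, by split_ifs <;> omega⟩, Fin.ext ?_⟩
    rw [hop, show red _ = w by simp only [red]; split_ifs <;> omega, hwz]
  · rw [hop]
    simp only [red]
    split_ifs <;> omega

theorem card_fin_choose_two_add (k : ℕ) :
    (Fintype.card (Fin (2 * k))).choose 2 + k = 2 * k * k := by
  rw [Fintype.card_fin, Nat.choose_two_right]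
  rcases k with _ | k
  · rfl
  rw [show 2 * (k + 1) * (2 * (k + 1) - 1) / 2 = (k + 1) * (2 * k + 1) by
    rw [show 2 * (k + 1) - 1 = 2 * k + 1 by omega]; apply Nat.div_eq_of_eq_mul_left <;> grind]
  ring

/-- Optimal covers of the pairs of `6k` points by triples. -/
theorem exists_pairCover_six_mul (k : ℕ) :
    ∃ B : Finset (Finset (Fin (2 * k) × ZMod 3)), IsPairCover B ∧
      6 * #B ≤ (6 * k) * (6 * k) := by
  obtain ⟨op, hop, hdiag⟩ := exists_halfIdempotent k
  let lo : Fin k → Fin (2 * k) := fun i => ⟨i, by omega⟩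
  let hi : Fin k → Fin (2 * k) := fun i => ⟨i + k, by omega⟩
  -- Both `lo i` and `hi i` square to `lo i`, so one triple covers two diagonal pairs.
  let extra : Fin k × ZMod 3 → Finset (Fin (2 * k) × ZMod 3) := fun p =>
    {(lo p.1, p.2), (lo p.1, p.2 + 1), (hi p.1, p.2)}
  have hlohi : ∀ i, hi i ≠ lo i := fun i h => by
    have h1 : (i : ℕ) + k = i := congrArg Fin.val h
    omega
  refine ⟨mixedTriples op ∪ univ.image extra, ?_, ?_⟩
  · refine exists_triple_of_mixedTriples_subset hop
      (Function.Embedding.refl _) (fun b hb => ?_) fun x j => ?_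
    · exact mem_union_left _ (by
        rwa [Function.Embedding.coe_refl, image_id])
    have hx := hdiag x
    by_cases hk : (x : ℕ) < k
    · obtain ⟨i, rfl⟩ : ∃ i, x = lo i := ⟨⟨x, hk⟩, rfl⟩
      rw [show op s(lo i, lo i) = lo i from Fin.ext (by rw [hx, if_pos hk])]
      exact ⟨(hi i, j), by simp [hlohi], by simp,
        mem_union_right _ (mem_image.2 ⟨(i, j), mem_univ _, rfl⟩)⟩
    · obtain ⟨i, rfl⟩ : ∃ i, x = hi i := ⟨⟨x - k, by omega⟩, Fin.ext (by simp only [hi]; omega)⟩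
      rw [show op s(hi i, hi i) = lo i from Fin.ext (by rw [hx, if_neg hk]; simp [hi, lo])]
      refine ⟨(lo i, j), by simp [(hlohi i).symm], by simp,
        mem_union_right _ (mem_image.2 ⟨(i, j), mem_univ _, ?_⟩)⟩
      ext z
      simp [extra]
      tauto
  · have h1 := card_mixedTriples_le op
    have h2 : #(univ.image extra) ≤ k * 3 := card_image_le.trans (by simp)
    have h3 := card_union_le (mixedTriples op) (univ.image extra)
    have h4 := card_fin_choose_two_add k
    nlinarith

/-- The Skolem construction of Steiner triple systems on `6k + 1` points. -/
theorem exists_pairCover_six_mul_add_one (k : ℕ) :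
    ∃ B : Finset (Finset (Option (Fin (2 * k) × ZMod 3))), IsPairCover B ∧
      6 * #B ≤ (6 * k + 1) * (6 * k) := by
  obtain ⟨op, hop, hdiag⟩ := exists_halfIdempotent k
  let lo : Fin k → Fin (2 * k) := fun i => ⟨i, by omega⟩
  let hi : Fin k → Fin (2 * k) := fun i => ⟨i + k, by omega⟩
  let vert : Fin k → Finset (Option (Fin (2 * k) × ZMod 3)) := fun i =>
    {some (lo i, 0), some (lo i, 1), some (lo i, 2)}
  -- Vertical triples cover the diagonal pairs of `lo i`; triples through the extra point `none`
  -- cover those of `hi i` and all pairs with `none`.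
  let infi : Fin k × ZMod 3 → Finset (Option (Fin (2 * k) × ZMod 3)) := fun p =>
    {none, some (hi p.1, p.2), some (lo p.1, p.2 + 1)}
  let B := (mixedTriples op).image (Finset.image some) ∪ (univ.image vert ∪ univ.image infi)
  have hinfi : ∀ i j, {none, some (hi i, j), some (lo i, j + 1)} ∈ B := fun i j =>
    mem_union_right _ (mem_union_right _ (mem_image.2 ⟨(i, j), mem_univ _, rfl⟩))
  have hlow : ∀ x : Fin (2 * k), (x : ℕ) < k → ∃ i, x = lo i := fun x hk => ⟨⟨x, hk⟩, rfl⟩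
  have hhigh : ∀ x : Fin (2 * k), ¬ (x : ℕ) < k → ∃ i, x = hi i := fun x hk =>
    ⟨⟨x - k, by omega⟩, Fin.ext (by simp only [hi]; omega)⟩
  have hnone : ∀ p, ∃ c, c ≠ none ∧ c ≠ some p ∧ {none, some p, c} ∈ B := by
    rintro ⟨x, j⟩
    by_cases hk : (x : ℕ) < k
    · obtain ⟨i, rfl⟩ := hlow x hk
      refine ⟨some (hi i, j - 1), by simp, by simp, ?_⟩
      have := hinfi i (j - 1)
      rwa [sub_add_cancel, pair_comm] at this
    · obtain ⟨i, rfl⟩ := hhigh x hk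
      exact ⟨some (lo i, j + 1), by simp, by simp, hinfi i j⟩
  have hsome := exists_triple_of_mixedTriples_subset hop (B := B)
      Function.Embedding.some (fun b hb => mem_union_left _ (mem_image_of_mem _ hb)) fun x j => by
    have hx := hdiag x
    by_cases hk : (x : ℕ) < k
    · obtain ⟨i, rfl⟩ := hlow x hk
      rw [show op s(lo i, lo i) = lo i from Fin.ext (by rw [hx, if_pos hk])]
      refine ⟨some (lo i, j + 2), ?_, ?_, mem_union_right _ (mem_union_left _
        (mem_image.2 ⟨i, mem_univ _, ?_⟩))⟩
      · simp; decide
      · simp; decide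
      · have : ∀ j : ZMod 3, ({0, 1, 2} : Finset (ZMod 3)) = {j, j + 1, j + 2} := by decide
        simpa [image_insert] using congrArg (Finset.image fun a => some (lo i, a)) (this j)
    · obtain ⟨i, rfl⟩ := hhigh x hk
      rw [show op s(hi i, hi i) = lo i from Fin.ext (by rw [hx, if_neg hk]; simp [hi, lo])]
      refine ⟨none, by simp, by simp, ?_⟩
      have := hinfi i j
      rwa [insert_comm, pair_comm none] at this
  refine ⟨B, ?_, ?_⟩
  · rintro (_ | p) (_ | q) hpq
    · exact absurd rfl hpq
    · exact hnone q
    · obtain ⟨c, h1, h2, h3⟩ := hnone p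
      exact ⟨c, h2, h1, by rwa [insert_comm]⟩
    · exact hsome p q fun h => hpq (by rw [h])
  · have h0 := card_mixedTriples_le op
    have h1 : #((mixedTriples op).image (Finset.image some)) ≤ #(mixedTriples op) := card_image_le
    have h2 : #(univ.image infi) ≤ k * 3 := card_image_le.trans (by simp)
    have h2' : #(univ.image vert) ≤ k := card_image_le.trans (by simp)
    have h3 : #B ≤ #((mixedTriples op).image (Finset.image some)) +
        (#(univ.image vert) + #(univ.image infi)) :=
      (card_union_le _ _).trans (Nat.add_le_add_left (card_union_le _ _) _)
    have h4 := card_fin_choose_two_add k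
    nlinarith

end PairCover

/-! ### The Turán number -/

theorem mul_exTrace_eq {U : Type*} {F : SimpleGraph U} {r n c N : ℕ}
    (hupper : ∀ H : Finset (Finset (Fin n)), (H : Set (Finset (Fin n))).Sized r →
      ¬ ContainsTrace H F → c * #H ≤ N)
    (hlower : ∃ H : Finset (Finset (Fin n)), (H : Set (Finset (Fin n))).Sized r ∧
      ¬ ContainsTrace H F ∧ N ≤ c * #H) : c * exTrace r n F = N := by
  obtain ⟨H, hH, hfree, hN⟩ := hlower
  have hbdd : BddAbove {m : ℕ | ∃ H : Finset (Finset (Fin n)),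
      (H : Set (Finset (Fin n))).Sized r ∧ ¬ ContainsTrace H F ∧ H.card = m} :=
    ⟨Fintype.card (Finset (Fin n)), by rintro _ ⟨H, -, -, rfl⟩; exact card_le_univ H⟩
  apply le_antisymm
  · obtain ⟨H', hH', hfree', hc⟩ := Nat.sSup_mem (Set.nonempty_of_mem
      (show _ ∈ {m : ℕ | ∃ H : Finset (Finset (Fin n)),
        (H : Set (Finset (Fin n))).Sized r ∧ ¬ ContainsTrace H F ∧ H.card = m} from
        ⟨H, hH, hfree, rfl⟩)) hbdd
    rw [exTrace, ← hc]
    exact hupper H' hH' hfree'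
  · exact hN.trans (Nat.mul_le_mul_left _ (le_csSup hbdd ⟨H, hH, hfree, rfl⟩))

/-- A cover of the pairs of `t + 2` points by few triples whose complement meets the upper bound
determines `ex_3(n, Tr(K_{1,t}))` for all multiples `n` of `t + 2`. -/
theorem six_mul_exTrace_star_eq {α : Type*} [DecidableEq α] [Fintype α] {B : Finset (Finset α)}
    (hB : IsPairCover B) {n t c : ℕ} (hα : Fintype.card α = t + 2) (ht : 0 < t)
    (hdvd : t + 2 ∣ n) (hc : ∀ d, 2 * d ≤ (t - 1) * (t + 1) → 2 * d ≤ c)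
    (hcard : 6 * #B + (t + 2) * c ≤ (t + 2) * (t + 1) * t) :
    6 * exTrace 3 n (completeBipartiteGraph (Fin 1) (Fin t)) = n * c := by
  obtain ⟨s, rfl⟩ : ∃ s, t = s + 1 := ⟨t - 1, by omega⟩
  refine mul_exTrace_eq (fun H hH hfree => ?_) ?_
  · simpa using six_mul_card_le hH fun v => hc _ (two_mul_card_filter_mem_le hH hfree v)
  · obtain ⟨m, rfl⟩ := hdvd
    have φ : Fin m × α ≃ Fin ((s + 1 + 2) * m) :=
      Fintype.equivFinOfCardEq (by simp [hα, mul_comm])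
    refine ⟨copiesOfCompl φ.toEmbedding B, sized_copiesOfCompl _ _,
      not_containsTrace_copiesOfCompl _ hB hα ht, ?_⟩
    have h1 := card_copiesOfCompl φ.toEmbedding B
    have h2 : 6 * (s + 1 + 2).choose 3 = (s + 1 + 2) * (s + 1 + 1) * (s + 1) := by
      have := Nat.descFactorial_eq_factorial_mul_choose (s + 1 + 2) 3
      simp [Nat.descFactorial_succ, Nat.factorial] at this
      rw [← this]; ring
    rw [hα] at h1
    have h3 := Nat.mul_le_mul_left m hcard
    rw [← h2] at h3
    nlinarith

theorem mainTheorem2 (n t : ℕ) (hdvd : t + 2 ∣ n) :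
    (t + 2 ≡ 0 [MOD 6] →
      (exTrace 3 n (completeBipartiteGraph (Fin 1) (Fin t)) : ℚ) =
        (n : ℚ) / 6 * ((t : ℚ) ^ 2 - 2)) ∧
    ((t + 2 ≡ 1 [MOD 6] ∨ t + 2 ≡ 3 [MOD 6]) →
      (exTrace 3 n (completeBipartiteGraph (Fin 1) (Fin t)) : ℚ) =
        (n : ℚ) / 6 * ((t : ℚ) ^ 2 - 1)) := by
  constructor
  · intro h
    obtain ⟨k, hk⟩ : ∃ k, t + 2 = 6 * k := (Nat.modEq_zero_iff_dvd.1 h)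
    obtain ⟨l, rfl⟩ : ∃ l, k = l + 1 := ⟨k - 1, by omega⟩
    obtain rfl : t = 6 * l + 4 := by omega
    obtain ⟨B, hB, hcard⟩ := exists_pairCover_six_mul (l + 1)
    -- Here `c = t² - 2`: the bound `t² - 1` is odd, while `2 * d` is even.
    have key := six_mul_exTrace_star_eq hB (n := n) (t := 6 * l + 4)
      (c := 36 * l ^ 2 + 48 * l + 14) (by simp [ZMod.card]; ring) (by omega) hdvd
      (fun d hd => by
        rw [show (6 * l + 4 - 1) * (6 * l + 4 + 1) = 2 * (18 * l ^ 2 + 24 * l + 7) + 1 by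
          rw [show 6 * l + 4 - 1 = 6 * l + 3 by omega]; ring] at hd
        omega)
      (by nlinarith)
    have key' : (6 : ℚ) * exTrace 3 n (completeBipartiteGraph (Fin 1) (Fin (6 * l + 4))) =
        n * (36 * l ^ 2 + 48 * l + 14) := by exact_mod_cast key
    push_cast
    linear_combination key' / 6
  · intro h
    have main : 6 * exTrace 3 n (completeBipartiteGraph (Fin 1) (Fin t)) =
        n * ((t - 1) * (t + 1)) := by
      rcases h with h | h
      · obtain ⟨k, rfl⟩ : ∃ k, t = 6 * k + 5 := ⟨t / 6, by unfold Nat.ModEq at h; omega⟩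
        obtain ⟨B, hB, hcard⟩ := exists_pairCover_six_mul_add_one (k + 1)
        refine six_mul_exTrace_star_eq hB (by simp [ZMod.card]; ring) (by omega) hdvd
          (fun d hd => hd) ?_
        rw [show 6 * k + 5 - 1 = 6 * k + 4 by omega]
        nlinarith
      · obtain ⟨k, rfl⟩ : ∃ k, t = 6 * k + 1 := ⟨t / 6, by unfold Nat.ModEq at h; omega⟩
        obtain ⟨B, hB, hcard⟩ := exists_pairCover_six_mul_add_three k
        refine six_mul_exTrace_star_eq hB (by simp [ZMod.card]; ring) (by omega) hdvd
          (fun d hd => hd) ?_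
        rw [show 6 * k + 1 - 1 = 6 * k by omega]
        nlinarith
    obtain ⟨s, rfl⟩ : ∃ s, t = s + 1 := ⟨t - 1, by
      rcases h with h | h <;> unfold Nat.ModEq at h <;> omega⟩
    have key' : (6 : ℚ) * exTrace 3 n (completeBipartiteGraph (Fin 1) (Fin (s + 1))) =
        n * (s * (s + 1 + 1)) := by exact_mod_cast main
    push_cast
    linear_combination key' / 6
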